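/- Let $V=\{A,B,C,\dots\}$ be a countably infinite alphabet of variables. A formula is a finite list of finite words over $V$, called its fragments; it is written with dots between the fragments, e.g. $ABA.ACA$ has the fragments $ABA$ and $ACA$. A morphism $h$ of free monoids is non-erasing if the image of every letter is non-empty. A right infinite word $w$ over an alphabet $\Sigma$ avoids a formula $f$ if there is no non-erasing morphism $h:V^*\to\Sigma^*$ such that $h(\varphi)$ is a factor of $w$ for every fragment $\varphi$ of $f$. For formulas $f',f$, write $f'\preceq f$ ($f$ is divisible by $f'$) if there is a non-erasing morphism $h:V^*\to V^*$ such that, for every fragment $\varphi$ of $f'$, $h(\varphi)$ is a factor of some fragment of $f$. An infinite word is recurrent if each of its finite factors occurs in it infinitely many times, and two infinite words are equivalent if they have the same set of finite factors. Let $b_3$ be the fixed point, starting with $0$, of the morphism $0\mapsto 012$, $1\mapsto 02$, $2\mapsto 1$ on $\{0,1,2\}^*$ (that is, the limit of the iterated images of $0$), and let $\sigma$ be the morphism $0\mapsto 1$, $1\mapsto 2$, $2\mapsto 0$. **Theorem.** Let $f$ be a formula such that - $ABCA.ABA.ACA\preceq f\preceq ABCA.ABA.ACA.ACB.CBA$,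 or - $ABCA.ABA.BCB.AC\preceq f\preceq ABCA.ABA.ABCBA.ACB$, or - $ABCA.ABA.BCB.CBA\preceq f\preceq ABCA.ABA.ABCBA.ACB$. Then every recurrent right infinite word over $\{0,1,2\}$ that avoids $f$ is equivalent to $b_3$, $\sigma(b_3)$ or $\sigma^2(b_3)$. -/

import Mathlib

namespace WordAvoid

/-- The image of the finite word `u` under the morphism of free monoids that sends each
letter `x` to the word `h x`. -/
def image {V α : Type*} (h : V → List α) (u : List V) : List α := u.flatMap h

/-- A morphism is non-erasing if the image of every letter is non-empty. -/
def NonErasing {V α : Type*} (h : V → List α) : Prop := ∀ x, h x ≠ []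

/-- The finite word `u` occurs at position `i` of the (right) infinite word `w`. -/
def OccursAt {α : Type*} (u : List α) (w : ℕ → α) (i : ℕ) : Prop :=
  ∀ (j : ℕ) (hj : j < u.length), w (i + j) = u[j]

/-- The finite word `u` is a factor of the (right) infinite word `w`. -/
def IsFactor {α : Type*} (u : List α) (w : ℕ → α) : Prop := ∃ i, OccursAt u w i

/-- An infinite word is recurrent if each of its finite factors occurs infinitely often. -/
def Recurrent {α : Type*} (w : ℕ → α) : Prop :=
  ∀ u : List α, IsFactor u w → {i | OccursAt u w i}.Infinite

/-- Two infinite words are equivalent if they have the same set of factors. -/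
def Equivalent {α : Type*} (w w' : ℕ → α) : Prop :=
  ∀ u : List α, IsFactor u w ↔ IsFactor u w'

/-- A formula over the countably infinite alphabet of variables `ℕ`: the finite list of its
fragments, each of which is a finite word of variables. -/
abbrev Formula := List (List ℕ)

/-- The variable `A`. -/
abbrev A : ℕ := 0

/-- The variable `B`. -/
abbrev B : ℕ := 1

/-- The variable `C`. -/
abbrev C : ℕ := 2

/-- `h` is an occurrence of the formula `f` in the infinite word `w`: a non-erasing morphism
that maps every fragment of `f` to a factor of `w`. -/
def IsOccurrence {α : Type*} (f : Formula) (w : ℕ → α) (h : ℕ → List α) : Prop :=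
  NonErasing h ∧ ∀ φ ∈ f, IsFactor (image h φ) w

/-- The infinite word `w` avoids the formula `f`. -/
def Avoids {α : Type*} (w : ℕ → α) (f : Formula) : Prop :=
  ¬ ∃ h : ℕ → List α, IsOccurrence f w h

/-- `Divides f' f` (written `f' ≼ f`): `f` is divisible by `f'`, that is, some non-erasing
morphism maps every fragment of `f'` to a factor of a fragment of `f`. -/
def Divides (f' f : Formula) : Prop :=
  ∃ h : ℕ → List ℕ, NonErasing h ∧ ∀ φ ∈ f', ∃ ψ ∈ f, image h φ <:+: ψ

infix:50 " ≼ " => Divides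

/-- The morphism `012/02/1` on the alphabet `{0, 1, 2}`. -/
def m3 : Fin 3 → List (Fin 3) := ![[0, 1, 2], [0, 2], [1]]

/-- The word `m3ⁿ(0)`. -/
def m3Iter (n : ℕ) : List (Fin 3) := (image m3)^[n] [0]

/-- The infinite word `b₃`, the fixed point of `m3`: the limit of the words `m3ⁿ(0)`.  Its letter
at position `n` is read off from `m3ⁿ(0)`, which has more than `n` letters; the default value is
never used, and every `m3ᵏ(0)` is a prefix of `b₃`, see `b3_spec`. -/
def b3 (n : ℕ) : Fin 3 := (m3Iter n).getD n 0

theorem m3Iter_succ (n : ℕ) : m3Iter (n + 1) = image m3 (m3Iter n) :=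
  Function.iterate_succ_apply' _ _ _

theorem m3Iter_prefix_succ (n : ℕ) : m3Iter n <+: m3Iter (n + 1) := by
  induction n with
  | zero => exact ⟨[1, 2], rfl⟩
  | succ n ih =>
    obtain ⟨t, ht⟩ := ih
    refine ⟨image m3 t, ?_⟩
    rw [m3Iter_succ (n + 1)]
    conv_rhs => rw [← ht]
    rw [m3Iter_succ n]
    simp [image]

theorem m3Iter_prefix {k n : ℕ} (h : k ≤ n) : m3Iter k <+: m3Iter n := by
  induction n, h using Nat.le_induction with
  | base => exact List.prefix_rfl
  | succ n _ ih => exact ih.trans (m3Iter_prefix_succ n)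

theorem length_le_image (u : List (Fin 3)) : u.length ≤ (image m3 u).length := by
  induction u with
  | nil => simp
  | cons a u ih =>
    have ha : 1 ≤ (m3 a).length := by revert a; decide
    simp only [image, List.flatMap_cons, List.length_append, List.length_cons] at ih ⊢
    omega

theorem lt_length_m3Iter (n : ℕ) : n < (m3Iter n).length := by
  have key : ∀ n, ∃ t, m3Iter n = 0 :: t ∧ n ≤ t.length := by
    intro n
    induction n with
    | zero => exact ⟨[], rfl, le_rfl⟩
    | succ n ih =>
      obtain ⟨t, ht, hl⟩ := ih
      refine ⟨1 :: 2 :: image m3 t, ?_, ?_⟩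
      · rw [m3Iter_succ, ht]; rfl
      · have := length_le_image t
        simp only [List.length_cons]
        omega
  obtain ⟨t, ht, hl⟩ := key n
  rw [ht, List.length_cons]
  omega

/-- Every `m3ᵏ(0)` is a prefix of `b₃`. -/
theorem b3_spec (k : ℕ) : OccursAt (m3Iter k) b3 0 := by
  intro j hj
  have h1 := lt_length_m3Iter j
  simp only [Nat.zero_add, b3, List.getD_eq_getElem _ _ h1]
  rcases le_total j k with h | h
  · exact (m3Iter_prefix h).getElem h1
  · exact ((m3Iter_prefix h).getElem hj).symm

/-- The letter-to-letter morphism `1/2/0`, which cyclically permutes the alphabet. -/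
def sigma : Fin 3 → Fin 3 := ![1, 2, 0]

end WordAvoid

open WordAvoid

namespace WordAvoid

/-! ### Morphisms and occurrences -/

/-! Avoidance passes upwards along `≼`, so `w` avoids one of the two maximal formulas. If `w` had a
square `uu`, recurrence would give `uuyuusuuyuu`, hence an occurrence of that formula; so `w` is
square-free.

Each of the six bijections from the variables to the letters maps some fragment to a non-factor of
`w`. A finite backtracking search over all choices of these non-factors shows that `010` and `212`,
up to one rotation of the alphabet, are not factors either (`rotation_of_forcesRotation`).

It remains to prove Thue's theorem for such words (`ThueLanguage.mem_iff`). It is stated for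
languages because the class is closed under preimage by `m3` (`ThueLanguage.preimage`). Iterating
the preimage puts every `m3ⁿ(0)` in the language. Conversely, a long word lies in the image of a
shorter word of the preimage (`exists_shorter`), and descent on length ends at words of at most 8
letters, which are checked by computation. -/

theorem image_append {V α : Type*} (h : V → List α) (u v : List V) :
    image h (u ++ v) = image h u ++ image h v := by
  simp [image]

theorem image_infix {V α : Type*} (h : V → List α) {u v : List V} (huv : u <:+: v) :
    image h u <:+: image h v := by
  obtain ⟨p, s, rfl⟩ := huv
  exact ⟨image h p, image h s, by simp [image_append]⟩

theorem image_ne_nil {V α : Type*} {h : V → List α} (hh : NonErasing h) {u : List V}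
    (hu : u ≠ []) : image h u ≠ [] := by
  cases u with
  | nil => exact absurd rfl hu
  | cons x u => simpa [image] using fun h0 => absurd h0 (hh x)

theorem image_image {U V α : Type*} (g : V → List α) (h : U → List V) (u : List U) :
    image g (image h u) = image (fun x => image g (h x)) u := by
  simp [image, List.flatMap_assoc]

theorem occursAt_append {α : Type*} {u v : List α} {w : ℕ → α} {i : ℕ} :
    OccursAt (u ++ v) w i ↔ OccursAt u w i ∧ OccursAt v w (i + u.length) := by
  constructor
  · intro h
    refine ⟨fun j hj => ?_, fun j hj => ?_⟩
    · rw [h j (by simp; omega), List.getElem_append_left hj]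
    · rw [Nat.add_assoc, h (u.length + j) (by simp; omega),
        List.getElem_append_right (by omega)]
      simp
  · rintro ⟨hu, hv⟩ j hj
    by_cases hju : j < u.length
    · rw [hu j hju, List.getElem_append_left hju]
    · have hj' : j - u.length < v.length := by simp at hj; omega
      rw [List.getElem_append_right (by omega), ← hv _ hj']
      congr 1
      omega

theorem occursAt_map_range {α : Type*} (w : ℕ → α) (i n : ℕ) :
    OccursAt ((List.range n).map fun j => w (i + j)) w i := by
  intro j hj
  simp

theorem IsFactor.of_infix {α : Type*} {u v : List α} {w : ℕ → α} (hv : IsFactor v w)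
    (huv : u <:+: v) : IsFactor u w := by
  obtain ⟨p, s, rfl⟩ := huv
  obtain ⟨i, hi⟩ := hv
  exact ⟨_, (occursAt_append.1 (occursAt_append.1 hi).1).2⟩

/-- In a recurrent word every factor returns, after a non-empty gap. -/
theorem Recurrent.exists_return {α : Type*} {w : ℕ → α} (hw : Recurrent w) {u : List α}
    (hu : IsFactor u w) : ∃ v, v ≠ [] ∧ IsFactor (u ++ v ++ u) w := by
  obtain ⟨i, hi⟩ := hu
  obtain ⟨j, hj, hij⟩ := (hw u ⟨i, hi⟩).exists_gt (i + u.length)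
  refine ⟨(List.range (j - (i + u.length))).map fun k => w (i + u.length + k), ?_, i, ?_⟩
  · simp
    omega
  · refine occursAt_append.2 ⟨occursAt_append.2 ⟨hi, occursAt_map_range _ _ _⟩, ?_⟩
    convert (show OccursAt u w j from hj) using 1
    simp
    omega

/-- An occurrence of `g` composed with the morphism witnessing `f ≼ g` is an occurrence of `f`. -/
theorem Avoids.of_divides {α : Type*} {w : ℕ → α} {f g : Formula} (hw : Avoids w f)
    (hfg : f ≼ g) : Avoids w g := by
  rintro ⟨k, hk, hfac⟩
  obtain ⟨h, hh, hinf⟩ := hfg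
  refine hw ⟨fun x => image k (h x), fun x => image_ne_nil hk (hh x), fun φ hφ => ?_⟩
  obtain ⟨ψ, hψ, hi⟩ := hinf φ hφ
  rw [← image_image]
  exact (hfac ψ hψ).of_infix (image_infix k hi)

/-! ### Square-free extendable languages -/

/-- A non-empty factorial language all of whose words can be extended on both sides and which
contains no square. -/
structure SquareFreeLanguage (L : Set (List (Fin 3))) : Prop where
  nil_mem : [] ∈ L
  of_infix : ∀ {u v}, u <:+: v → v ∈ L → u ∈ L
  exists_right : ∀ {u}, u ∈ L → ∃ x, u ++ [x] ∈ L
  exists_left : ∀ {u}, u ∈ L → ∃ x, x :: u ∈ L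
  square_notMem : ∀ {u}, u ≠ [] → u ++ u ∉ L

theorem SquareFreeLanguage.notMem {L : Set (List (Fin 3))} (hL : SquareFreeLanguage L)
    {u v : List (Fin 3)} (hu : u ∉ L) (p s : List (Fin 3)) (h : p ++ u ++ s = v) : v ∉ L :=
  fun hv => hu (hL.of_infix ⟨p, s, h⟩ hv)

theorem SquareFreeLanguage.square_infix {L : Set (List (Fin 3))} (hL : SquareFreeLanguage L)
    (u : List (Fin 3)) (hu : u ≠ []) {v : List (Fin 3)} (p s : List (Fin 3))
    (h : p ++ (u ++ u) ++ s = v) : v ∉ L :=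
  hL.notMem (hL.square_notMem hu) p s h

/-- The word `z` begins with a square. -/
def squarePrefix (z : List (Fin 3)) : Bool :=
  (List.range (z.length / 2)).any fun p => (z.take (p + 1)).isPrefixOf (z.drop (p + 1))

/-- The word `z` begins or ends with a square or with a word of `X`. -/
def conflict (X : List (List (Fin 3))) (z : List (Fin 3)) : Bool :=
  X.any (fun f => f.isPrefixOf z || f.isSuffixOf z) || squarePrefix z || squarePrefix z.reverse

/-- Every extension of `z` by `n` letters, added alternately on both sides, runs into a square
or a word of `X`. -/
def refuted (X : List (List (Fin 3))) : ℕ → List (Fin 3) → Bool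
  | 0, z => conflict X z
  | n + 1, z => conflict X z ||
      bif n % 2 == 0 then [0, 1, 2].all fun c => refuted X n (z ++ [c])
      else [0, 1, 2].all fun c => refuted X n (c :: z)

theorem exists_square_of_squarePrefix {z : List (Fin 3)} (hz : squarePrefix z = true) :
    ∃ u ≠ [], u ++ u <+: z := by
  simp only [squarePrefix, List.any_eq_true, List.mem_range, List.isPrefixOf_iff_prefix] at hz
  obtain ⟨p, hp, s, hs⟩ := hz
  refine ⟨z.take (p + 1), ?_, s, ?_⟩
  · intro h
    have := congrArg List.length h
    rw [List.length_take, List.length_nil] at this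
    omega
  · rw [List.append_assoc, hs, List.take_append_drop]

theorem SquareFreeLanguage.conflict_notMem {L : Set (List (Fin 3))} (hL : SquareFreeLanguage L)
    {X : List (List (Fin 3))} (hX : ∀ f ∈ X, f ∉ L) {z : List (Fin 3)}
    (hz : conflict X z = true) : z ∉ L := by
  intro hzL
  simp only [conflict, Bool.or_eq_true, List.any_eq_true, List.isPrefixOf_iff_prefix,
    List.isSuffixOf_iff_suffix] at hz
  rcases hz with (⟨f, hf, h | h⟩ | h) | h
  · exact hX f hf (hL.of_infix h.isInfix hzL)
  · exact hX f hf (hL.of_infix h.isInfix hzL)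
  · obtain ⟨u, hu, h⟩ := exists_square_of_squarePrefix h
    exact hL.square_notMem hu (hL.of_infix h.isInfix hzL)
  · obtain ⟨u, hu, h⟩ := exists_square_of_squarePrefix h
    have h' := List.reverse_suffix.2 h
    rw [List.reverse_reverse, List.reverse_append] at h'
    exact hL.square_notMem (by simpa using hu) (hL.of_infix h'.isInfix hzL)

/-- A word of `L` extends within `L` on whichever side the search chooses, so one branch would stay
in `L` down to a conflict. Only soundness matters, hence `conflict` may look at the two ends alone.
-/
theorem SquareFreeLanguage.refuted_notMem {L : Set (List (Fin 3))} (hL : SquareFreeLanguage L)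
    {X : List (List (Fin 3))} (hX : ∀ f ∈ X, f ∉ L) {n : ℕ} {z : List (Fin 3)}
    (hz : refuted X n z = true) : z ∉ L := by
  induction n generalizing z with
  | zero => exact hL.conflict_notMem hX hz
  | succ n ih =>
    have hall : ∀ c : Fin 3, c ∈ [(0 : Fin 3), 1, 2] := by decide
    rw [refuted, Bool.or_eq_true] at hz
    rcases hz with hz | hz
    · exact hL.conflict_notMem hX hz
    · intro hzL
      cases hn : n % 2 == 0 <;> rw [hn] at hz <;>
        simp only [cond_true, cond_false, List.all_eq_true] at hz
      · obtain ⟨c, hc⟩ := hL.exists_left hzL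
        exact ih (hz c (hall c)) hc
      · obtain ⟨c, hc⟩ := hL.exists_right hzL
        exact ih (hz c (hall c)) hc

/-- If excluding `t` on top of `X` leaves no infinite language, then `t` is in the language. -/
theorem SquareFreeLanguage.mem_of_refuted {L : Set (List (Fin 3))} (hL : SquareFreeLanguage L)
    {X : List (List (Fin 3))} (hX : ∀ f ∈ X, f ∉ L) {t : List (Fin 3)} (n : ℕ)
    (h : refuted (t :: X) n [] = true) : t ∈ L := by
  by_contra ht
  refine hL.refuted_notMem ?_ h hL.nil_mem
  intro f hf
  rcases List.mem_cons.1 hf with rfl | hf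
  · exact ht
  · exact hX f hf

/-! ### Excluding `010` and `212` up to a rotation of the alphabet -/

/-- The words `010` and `212`, rotated by some `k`, are both refuted by `X`. -/
def refutesRotation (X : List (List (Fin 3))) : Bool :=
  [0, 1, 2].any fun k : Fin 3 => refuted X 30 [k, 1 + k, k] && refuted X 30 [2 + k, 1 + k, 2 + k]

/-- However a word is selected in each member of the given list, excluding the selected words and
those of `X` also excludes `010` and `212`, rotated by some `k`. -/
def forcesRotation : List (List (Fin 3)) → List (List (List (Fin 3))) → Bool
  | X, [] => refutesRotation X
  | X, Y :: Z => refutesRotation X ||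
      bif Y.any fun y => X.any fun f => y.tails.any fun s => f.isPrefixOf s then forcesRotation X Z
      else Y.all fun y => forcesRotation (y :: X) Z

theorem SquareFreeLanguage.rotation_of_refutesRotation {L : Set (List (Fin 3))}
    (hL : SquareFreeLanguage L) {X : List (List (Fin 3))} (hX : ∀ f ∈ X, f ∉ L)
    (h : refutesRotation X = true) :
    ∃ k : Fin 3, [k, 1 + k, k] ∉ L ∧ [2 + k, 1 + k, 2 + k] ∉ L := by
  simp only [refutesRotation, List.any_eq_true, Bool.and_eq_true] at h
  obtain ⟨k, -, h1, h2⟩ := h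
  exact ⟨k, hL.refuted_notMem hX h1, hL.refuted_notMem hX h2⟩

theorem SquareFreeLanguage.rotation_of_forcesRotation {L : Set (List (Fin 3))}
    (hL : SquareFreeLanguage L) {Z : List (List (List (Fin 3)))}
    (hZ : ∀ Y ∈ Z, ∃ y ∈ Y, y ∉ L) {X : List (List (Fin 3))} (hX : ∀ f ∈ X, f ∉ L)
    (h : forcesRotation X Z = true) :
    ∃ k : Fin 3, [k, 1 + k, k] ∉ L ∧ [2 + k, 1 + k, 2 + k] ∉ L := by
  induction Z generalizing X with
  | nil => exact hL.rotation_of_refutesRotation hX h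
  | cons Y Z ih =>
    rw [forcesRotation, Bool.or_eq_true] at h
    have hZ' : ∀ Y ∈ Z, ∃ y ∈ Y, y ∉ L := fun Y hY => hZ Y (List.mem_cons_of_mem _ hY)
    rcases h with h | h
    · exact hL.rotation_of_refutesRotation hX h
    · rw [cond_eq_ite] at h
      split at h
      -- Some word of `Y` already contains an excluded word, so `Y` gives no new information and is
      -- dropped.
      · exact ih hZ' hX h
      · obtain ⟨y, hy, hyL⟩ := hZ Y List.mem_cons_self
        refine ih hZ' ?_ (List.all_eq_true.1 h y hy)
        intro f hf
        rcases List.mem_cons.1 hf with rfl | hf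
        · exact hyL
        · exact hX f hf

/-- The morphism that maps the variables to the single letters `a`, `b` and `c`. -/
def letterMorphism (a b c : Fin 3) : ℕ → List (Fin 3)
  | 0 => [a]
  | 1 => [b]
  | _ => [c]

theorem nonErasing_letterMorphism (a b c : Fin 3) : NonErasing (letterMorphism a b c) := by
  intro x
  unfold letterMorphism
  split <;> simp

/-- The images of the fragments of `f` under the six letter-to-letter morphisms given by the
permutations of the alphabet. -/
def letterImages (f : Formula) : List (List (List (Fin 3))) :=
  [letterMorphism 0 1 2, letterMorphism 0 2 1, letterMorphism 1 0 2, letterMorphism 1 2 0,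
    letterMorphism 2 0 1, letterMorphism 2 1 0].map fun h => f.map (image h)

theorem forcesRotation_five_fragments :
    forcesRotation []
      (letterImages [[A, B, C, A], [A, B, A], [A, C, A], [A, C, B], [C, B, A]]) = true := by
  decide +kernel

theorem forcesRotation_four_fragments :
    forcesRotation [] (letterImages [[A, B, C, A], [A, B, A], [A, B, C, B, A], [A, C, B]]) =
      true := by
  decide +kernel

/-! ### The language of factors of a recurrent word -/

/-- A square `uu` in a recurrent word gives the factor `uuyuusuuyuu`, which contains the images of
all fragments under `A ↦ u`, `B ↦ uyu`, `C ↦ usu`. -/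
theorem Recurrent.not_isFactor_square {α : Type*} {w : ℕ → α} (hw : Recurrent w) {f : Formula}
    (hf : f = [[A, B, C, A], [A, B, A], [A, C, A], [A, C, B], [C, B, A]] ∨
      f = [[A, B, C, A], [A, B, A], [A, B, C, B, A], [A, C, B]])
    (hav : Avoids w f) {u : List α} (hu : u ≠ []) : ¬ IsFactor (u ++ u) w := by
  intro hsq
  obtain ⟨y, -, hy⟩ := hw.exists_return hsq
  obtain ⟨s, -, hs⟩ := hw.exists_return hy
  have key : ∀ v p q, p ++ v ++ q = u ++ u ++ y ++ (u ++ u) ++ s ++ (u ++ u ++ y ++ (u ++ u)) →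
      IsFactor v w := fun v p q h => hs.of_infix ⟨p, q, h⟩
  set h : ℕ → List α := fun n => match n with
    | 0 => u
    | 1 => u ++ y ++ u
    | _ => u ++ s ++ u with hh
  have hA : h 0 = u := rfl
  have hB : h 1 = u ++ y ++ u := rfl
  have hC : h 2 = u ++ s ++ u := rfl
  have hne : NonErasing h := by
    intro n
    match n with
    | 0 => simpa [hh] using hu
    | 1 => simp [hh, hu]
    | n + 2 => simp [hh, hu]
  have abca : IsFactor (image h [A, B, C, A]) w :=
    key _ [] (y ++ (u ++ u)) (by simp [image, hA, hB, hC])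
  have aba : IsFactor (image h [A, B, A]) w :=
    key _ [] (s ++ (u ++ u ++ y ++ (u ++ u))) (by simp [image, hA, hB])
  have aca : IsFactor (image h [A, C, A]) w :=
    key _ (u ++ u ++ y) (y ++ (u ++ u)) (by simp [image, hA, hC])
  have acb : IsFactor (image h [A, C, B]) w :=
    key _ (u ++ u ++ y) u (by simp [image, hA, hB, hC])
  have cba : IsFactor (image h [C, B, A]) w :=
    key _ (u ++ u ++ y ++ u) [] (by simp [image, hA, hB, hC])
  have abcba : IsFactor (image h [A, B, C, B, A]) w :=
    key _ [] [] (by simp [image, hA, hB, hC])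
  refine hav ⟨h, hne, ?_⟩
  rcases hf with rfl | rfl <;> simp only [List.forall_mem_cons]
  · exact ⟨abca, aba, aca, acb, cba, by simp⟩
  · exact ⟨abca, aba, abcba, acb, by simp⟩

theorem Recurrent.squareFreeLanguage {w : ℕ → Fin 3} (hw : Recurrent w)
    (hsq : ∀ u : List (Fin 3), u ≠ [] → ¬ IsFactor (u ++ u) w) :
    SquareFreeLanguage {u | IsFactor u w} where
  nil_mem := ⟨0, fun j hj => absurd hj (by simp)⟩
  of_infix huv hv := IsFactor.of_infix hv huv
  exists_right := by
    rintro u ⟨i, hi⟩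
    refine ⟨w (i + u.length), i, occursAt_append.2 ⟨hi, ?_⟩⟩
    intro j hj
    have : j = 0 := by simpa using hj
    subst this
    rfl
  exists_left := by
    intro u hu
    -- Recurrence gives an occurrence away from position 0, which has a letter before it.
    obtain ⟨i, hi, hpos⟩ := (hw u hu).exists_gt 0
    refine ⟨w (i - 1), i - 1, ?_⟩
    refine (occursAt_append (u := [w (i - 1)])).2 ⟨?_, ?_⟩
    · intro j hj
      have : j = 0 := by simpa using hj
      subst this
      rfl
    · have : i - 1 + [w (i - 1)].length = i := by simp; omega
      rw [this]
      exact hi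
  square_notMem := fun {u} hu => hsq u hu

/-! ### Square-free languages without `010` and `212` -/

/-- A square-free language without the words `010` and `212`. -/
structure ThueLanguage (L : Set (List (Fin 3))) : Prop extends SquareFreeLanguage L where
  notMem_010 : [0, 1, 0] ∉ L
  notMem_212 : [2, 1, 2] ∉ L

namespace ThueLanguage

variable {L : Set (List (Fin 3))}

theorem forall_notMem (hL : ThueLanguage L) :
    ∀ f ∈ [[(0 : Fin 3), 1, 0], [2, 1, 2]], f ∉ L := by
  simp [hL.notMem_010, hL.notMem_212]

/-- This word and the next two are `m3(0)`, `m3(21)` and `m3(12)`: they provide the extensions of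
very short words in `preimage`. -/
theorem mem_012 (hL : ThueLanguage L) : [0, 1, 2] ∈ L :=
  hL.mem_of_refuted hL.forall_notMem 20 (by decide +kernel)

theorem mem_102 (hL : ThueLanguage L) : [1, 0, 2] ∈ L :=
  hL.mem_of_refuted hL.forall_notMem 20 (by decide +kernel)

theorem mem_021 (hL : ThueLanguage L) : [0, 2, 1] ∈ L :=
  hL.mem_of_refuted hL.forall_notMem 20 (by decide +kernel)

/-- `1021` is `m3(212)`, so this excludes `212` from the preimage. -/
theorem notMem_1021 (hL : ThueLanguage L) : [1, 0, 2, 1] ∉ L :=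
  hL.refuted_notMem hL.forall_notMem (n := 20) (by decide +kernel)

/-- Before a position that follows the letter `2`, a block `012` or `02` can be completed. -/
theorem complete_left (hL : ThueLanguage L) {t : List (Fin 3)} (ht : 2 :: t ∈ L) :
    ∃ x, m3 x ++ t ∈ L := by
  obtain ⟨b, hb⟩ := hL.exists_left ht
  fin_cases b
  · exact ⟨1, hb⟩
  · obtain ⟨c, hc⟩ := hL.exists_left hb
    fin_cases c
    · exact ⟨0, hc⟩
    · exact absurd hc (hL.square_infix [1] (by simp) [] (2 :: t) rfl)
    · exact absurd hc (hL.notMem hL.notMem_212 [] t rfl)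
  · exact absurd hb (hL.square_infix [2] (by simp) [] t rfl)

/-- The letters `01` at the end of a word are followed by `2`. -/
theorem append_012 (hL : ThueLanguage L) {t : List (Fin 3)} (ht : t ++ [0, 1] ∈ L) :
    t ++ [0, 1, 2] ∈ L := by
  obtain ⟨c, hc⟩ := hL.exists_right ht
  fin_cases c
  · exact absurd hc (hL.notMem hL.notMem_010 t [] (by simp))
  · exact absurd hc (hL.square_infix [1] (by simp) (t ++ [0]) [] (by simp))
  · simpa using hc

/-- A block that begins with `0` at the end of a word can be completed to `012` or `02`. -/
theorem complete_right (hL : ThueLanguage L) {t : List (Fin 3)} (ht : t ++ [0] ∈ L) :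
    t ++ m3 0 ∈ L ∨ t ++ m3 1 ∈ L := by
  obtain ⟨b, hb⟩ := hL.exists_right ht
  fin_cases b
  · exact absurd hb (hL.square_infix [0] (by simp) t [] (by simp))
  · exact Or.inl (hL.append_012 (by simpa using hb))
  · exact Or.inr (by simpa [m3] using hb)

theorem nonErasing_m3 : NonErasing m3 := by
  unfold NonErasing
  decide

/-- The preimage of such a language under `m3` is again such a language. -/
theorem preimage (hL : ThueLanguage L) : ThueLanguage {u | image m3 u ∈ L} where
  nil_mem := hL.nil_mem
  of_infix huv hv := hL.of_infix (image_infix m3 huv) hv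
  exists_right := by
    intro u hu
    change image m3 u ∈ L at hu
    simp only [Set.mem_ofPred_eq, image_append]
    obtain ⟨a, ha⟩ := hL.exists_right hu
    fin_cases a
    · rcases hL.complete_right ha with h | h
      · exact ⟨0, by simpa [image] using h⟩
      · exact ⟨1, by simpa [image] using h⟩
    · exact ⟨2, ha⟩
    -- No block begins with `2`. After a complete block, `2` would create `22`, `212` or `11`,
    -- unless `u` is empty or the single letter `2`; there another extension is supplied.
    · rcases List.eq_nil_or_concat u with rfl | ⟨v, y, rfl⟩
      · exact ⟨0, hL.mem_012⟩
      rw [List.concat_eq_append] at ha ⊢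
      rw [image_append] at ha ⊢
      fin_cases y
      · exact absurd ha (hL.square_infix [2] (by simp) (image m3 v ++ [0, 1]) []
          (by simp [image, m3]))
      · exact absurd ha (hL.square_infix [2] (by simp) (image m3 v ++ [0]) []
          (by simp [image, m3]))
      · rcases List.eq_nil_or_concat v with rfl | ⟨v, z, rfl⟩
        · exact ⟨1, hL.mem_102⟩
        rw [List.concat_eq_append, image_append] at ha
        fin_cases z
        · exact absurd ha (hL.notMem hL.notMem_212 (image m3 v ++ [0, 1]) []
            (by simp [image, m3]))
        · exact absurd ha (hL.notMem hL.notMem_212 (image m3 v ++ [0]) []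
            (by simp [image, m3]))
        · exact absurd ha (hL.square_infix [1] (by simp) (image m3 v) [2]
            (by simp [image, m3]))
  exists_left := by
    intro u hu
    change image m3 u ∈ L at hu
    change ∃ x, m3 x ++ image m3 u ∈ L
    obtain ⟨a, ha⟩ := hL.exists_left hu
    fin_cases a
    -- Likewise no block ends with `0`, and only the empty word and the single letter `2` survive.
    · rcases u with _ | ⟨y, v⟩
      · exact ⟨0, hL.mem_012⟩
      fin_cases y
      · exact absurd ha (hL.square_infix [0] (by simp) [] (1 :: 2 :: image m3 v) rfl)
      · exact absurd ha (hL.square_infix [0] (by simp) [] (2 :: image m3 v) rfl)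
      · rcases v with _ | ⟨z, v⟩
        · exact ⟨1, hL.mem_021⟩
        fin_cases z
        · exact absurd ha (hL.notMem hL.notMem_010 [] (1 :: 2 :: image m3 v) rfl)
        · exact absurd ha (hL.notMem hL.notMem_010 [] (2 :: image m3 v) rfl)
        · exact absurd ha (hL.square_infix [1] (by simp) [0] (image m3 v) rfl)
    · exact ⟨2, ha⟩
    · exact hL.complete_left ha
  square_notMem := by
    intro u hu h
    rw [Set.mem_ofPred_eq, image_append] at h
    exact hL.square_notMem (image_ne_nil nonErasing_m3 hu) h
  notMem_010 := hL.square_infix [2, 0] (by simp) [0, 1] [1, 2] rfl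
  notMem_212 := hL.notMem_1021

/-- Parsing into blocks `012`, `02` and `1`: after a prefix `s` that ends at the end of a
block, a word `t` is a prefix of an image under `m3`, of length about `2|t|/3` at most. -/
theorem exists_parse (hL : ThueLanguage L) : ∀ (t s : List (Fin 3)), s ++ t ∈ L →
    s ++ [2] ∉ L → s ++ [1, 2] ∉ L → ∃ v, s ++ image m3 v ∈ L ∧ t <+: image m3 v ∧
      3 * v.length ≤ 2 * t.length + 2 ∧
      ((∀ t', t ≠ 1 :: t') → 3 * v.length ≤ 2 * t.length + 1)
  | [], s, h, _, _ => ⟨[], h, List.nil_prefix, by simp, by simp⟩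
  | 2 :: t, s, h, h2, _ => absurd h (hL.notMem h2 [] t (by simp))
  | 1 :: t, s, h, _, h12 => by
    obtain ⟨v, hv, ⟨r, hr⟩, -, hlen⟩ := exists_parse hL t (s ++ [1]) (by simpa using h)
      (by simpa using h12) (hL.square_infix [1] (by simp) s [2] (by simp))
    refine ⟨2 :: v, by simpa [image, m3] using hv, ⟨r, ?_⟩, ?_, fun ht' => ?_⟩
    · rw [List.cons_append, hr]
      rfl
    -- Two blocks `1` are never adjacent, so consecutive blocks have at least 3 letters together:
    -- this is the source of the ratio 2/3 and of the sharper bound when `t` does not begin with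
    -- `1`.
    · have ht : ∀ t', t ≠ 1 :: t' := by
        rintro t' rfl
        exact hL.square_infix [1] (by simp) s t' (by simp) h
      have := hlen ht
      simp
      omega
    · exact absurd rfl (ht' t)
  | [0], s, h, _, _ => by
    rcases hL.complete_right h with h | h
    · exact ⟨[0], by simpa [image] using h, ⟨[1, 2], rfl⟩, by simp, by simp⟩
    · exact ⟨[1], by simpa [image] using h, ⟨[2], rfl⟩, by simp, by simp⟩
  | 0 :: 0 :: t, s, h, _, _ => absurd h (hL.square_infix [0] (by simp) s t (by simp))
  | [0, 1], s, h, _, _ => ⟨[0], by simpa [image, m3] using hL.append_012 h, ⟨[2], rfl⟩,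
      by simp, by simp⟩
  | 0 :: 1 :: 0 :: t, s, h, _, _ => absurd h (hL.notMem hL.notMem_010 s t (by simp))
  | 0 :: 1 :: 1 :: t, s, h, _, _ =>
    absurd h (hL.square_infix [1] (by simp) (s ++ [0]) t (by simp))
  | 0 :: 1 :: 2 :: t, s, h, _, _ => by
    obtain ⟨v, hv, ⟨r, hr⟩, hlen, -⟩ := exists_parse hL t (s ++ [0, 1, 2]) (by simpa using h)
      (hL.square_infix [2] (by simp) (s ++ [0, 1]) [] (by simp))
      (hL.notMem hL.notMem_212 (s ++ [0, 1]) [] (by simp))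
    refine ⟨0 :: v, by simpa [image, m3] using hv, ⟨r, ?_⟩, ?_, fun _ => ?_⟩
    · simp only [List.cons_append, hr]
      rfl
    · simp; omega
    · simp; omega
  | 0 :: 2 :: t, s, h, _, _ => by
    obtain ⟨v, hv, ⟨r, hr⟩, hlen, -⟩ := exists_parse hL t (s ++ [0, 2]) (by simpa using h)
      (hL.square_infix [2] (by simp) (s ++ [0]) [] (by simp))
      (hL.notMem hL.notMem_212 (s ++ [0]) [] (by simp))
    refine ⟨1 :: v, by simpa [image, m3] using hv, ⟨r, ?_⟩, ?_, fun _ => ?_⟩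
    · simp only [List.cons_append, hr]
      rfl
    · simp; omega
    · simp; omega

/-- A word of length at least `9` is a factor of the image of a shorter word. -/
theorem exists_shorter (hL : ThueLanguage L) {u : List (Fin 3)} (hu : u ∈ L)
    (hlen : 9 ≤ u.length) :
    ∃ v, image m3 v ∈ L ∧ u <:+: image m3 v ∧ v.length < u.length := by
  -- A `2` always ends a block, so parsing can start right after one. Four letters to the left
  -- suffice to meet a `2`.
  obtain ⟨d, hd⟩ := hL.exists_left hu
  obtain ⟨c, hc⟩ := hL.exists_left hd
  obtain ⟨b, hb⟩ := hL.exists_left hc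
  obtain ⟨a, ha⟩ := hL.exists_left hb
  have key : ∀ s t, s ++ [2] ++ (t ++ u) ∈ L → t.length ≤ 3 →
      ∃ v, image m3 v ∈ L ∧ u <:+: image m3 v ∧ v.length < u.length := by
    intro s t h ht
    obtain ⟨v, hv, hp, hlv, -⟩ := hL.exists_parse (t ++ u) (s ++ [2]) h
      (hL.square_infix [2] (by simp) s [] (by simp))
      (hL.notMem hL.notMem_212 s [] (by simp))
    refine ⟨v, hL.of_infix (List.suffix_append _ _).isInfix hv,
      (List.suffix_append t u).isInfix.trans hp.isInfix, ?_⟩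
    -- With at most 3 letters prepended, `3|v| ≤ 2(|u| + 3) + 2`, which is less than `3|u|` exactly
    -- when `|u| ≥ 9`.
    rw [List.length_append] at hlv
    omega
  -- A word of length 4 over `{0, 1}` contains `00`, `11` or `010`.
  have cases_abcd : ∀ a b c d : Fin 3, a = 2 ∨ b = 2 ∨ c = 2 ∨ d = 2 ∨ a = b ∨ b = c ∨ c = d ∨
      (a = 0 ∧ b = 1 ∧ c = 0) ∨ (b = 0 ∧ c = 1 ∧ d = 0) := by decide
  rcases cases_abcd a b c d with rfl | rfl | rfl | rfl | rfl | rfl | rfl | ⟨rfl, rfl, rfl⟩ |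
    ⟨rfl, rfl, rfl⟩
  · exact key [] [b, c, d] ha (by simp)
  · exact key [a] [c, d] ha (by simp)
  · exact key [a, b] [d] ha (by simp)
  · exact key [a, b, c] [] ha (by simp)
  · exact absurd ha (hL.square_infix [a] (by simp) [] (c :: d :: u) rfl)
  · exact absurd ha (hL.square_infix [b] (by simp) [a] (d :: u) rfl)
  · exact absurd ha (hL.square_infix [c] (by simp) [a, b] u rfl)
  · exact absurd ha (hL.notMem hL.notMem_010 [] (d :: u) rfl)
  · exact absurd ha (hL.notMem hL.notMem_010 [a] u rfl)

end ThueLanguage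

/-! ### The factors of `b3` -/

theorem OccursAt.prefix_of_le {α : Type*} {u v : List α} {w : ℕ → α} {i : ℕ}
    (hu : OccursAt u w i) (hv : OccursAt v w i) (h : u.length ≤ v.length) : u <+: v := by
  rw [List.prefix_iff_getElem]
  exact ⟨h, fun j hj => by rw [← hu j hj, ← hv j (by omega)]⟩

theorem isFactor_b3_iff {u : List (Fin 3)} : IsFactor u b3 ↔ ∃ n, u <:+: m3Iter n := by
  constructor
  · rintro ⟨i, hi⟩
    -- `m3ⁿ(0)` has more than `n` letters, so this prefix of `b3` reaches past the occurrence of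
    -- `u`.
    refine ⟨i + u.length, ?_⟩
    have h : OccursAt ((List.range i).map (fun j => b3 (0 + j)) ++ u) b3 0 :=
      occursAt_append.2 ⟨occursAt_map_range _ _ _, by simpa using hi⟩
    have hp := h.prefix_of_le (b3_spec (i + u.length))
      (by simpa using (lt_length_m3Iter (i + u.length)).le)
    exact (List.suffix_append _ u).isInfix.trans hp.isInfix
  · rintro ⟨n, hn⟩
    exact IsFactor.of_infix ⟨0, b3_spec n⟩ hn

theorem IsFactor.image_m3 {u : List (Fin 3)} (hu : IsFactor u b3) :
    IsFactor (image m3 u) b3 := by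
  obtain ⟨n, hn⟩ := isFactor_b3_iff.1 hu
  exact isFactor_b3_iff.2 ⟨n + 1, m3Iter_succ n ▸ image_infix m3 hn⟩

/-- Every extension of `z` by at most `n` letters on the right occurs in `t`, unless it is refuted
by `X` in `k` steps. -/
def covers (X : List (List (Fin 3))) (t : List (Fin 3)) (k : ℕ) : ℕ → List (Fin 3) → Bool
  | 0, z => refuted X k z || t.tails.any fun s => z.isPrefixOf s
  | n + 1, z => refuted X k z || ((t.tails.any fun s => z.isPrefixOf s) &&
      [0, 1, 2].all fun c => covers X t k n (z ++ [c]))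

theorem SquareFreeLanguage.infix_of_covers {L : Set (List (Fin 3))} (hL : SquareFreeLanguage L)
    {X : List (List (Fin 3))} (hX : ∀ f ∈ X, f ∉ L) {t : List (Fin 3)} {k n : ℕ}
    {z u : List (Fin 3)} (h : covers X t k n z = true) (hu : u.length ≤ n) (hzu : z ++ u ∈ L) :
    z ++ u <:+: t := by
  have hz : ¬ refuted X k z = true := fun hr =>
    hL.refuted_notMem hX hr (hL.of_infix (List.prefix_append z u).isInfix hzu)
  have hinf : (t.tails.any fun s => z.isPrefixOf s) = true → z <:+: t := by
    simp only [List.any_eq_true, List.mem_tails, List.isPrefixOf_iff_prefix]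
    rintro ⟨s, hs, hp⟩
    exact hp.isInfix.trans hs.isInfix
  induction n generalizing z u with
  | zero =>
    obtain rfl : u = [] := List.eq_nil_of_length_eq_zero (by omega)
    rw [covers, Bool.or_eq_true] at h
    simpa using hinf (h.resolve_left hz)
  | succ n ih =>
    rw [covers, Bool.or_eq_true, Bool.and_eq_true] at h
    obtain ⟨hp, hall⟩ := h.resolve_left hz
    rcases u with _ | ⟨c, u⟩
    · simpa using hinf hp
    have hc : ∀ c : Fin 3, c ∈ [(0 : Fin 3), 1, 2] := by decide
    have hzu' : z ++ [c] ++ u ∈ L := by simpa using hzu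
    have := ih (List.all_eq_true.1 hall c (hc c)) (by simpa using hu) hzu'
      (fun hr => hL.refuted_notMem hX hr (hL.of_infix (List.prefix_append _ u).isInfix hzu'))
      (by
        simp only [List.any_eq_true, List.mem_tails, List.isPrefixOf_iff_prefix]
        rintro ⟨s, hs, hp⟩
        exact hp.isInfix.trans hs.isInfix)
    simpa using this

namespace ThueLanguage

variable {L : Set (List (Fin 3))}

/-- Base of the descent: 8 is the largest length not treated by `exists_shorter`, and 20 is the
search depth for refuting words absent from `m3⁶(0)`. -/
theorem covers_m3Iter :
    covers [[0, 1, 0], [2, 1, 2]] (m3Iter 6) 20 8 [] = true := by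
  decide +kernel

/-- Descent on length with the language varying: the shorter word belongs to the preimage language,
and the factors of `b3` are stable under `m3`. -/
theorem isFactor_b3 {L : Set (List (Fin 3))} (hL : ThueLanguage L) {u : List (Fin 3)}
    (hu : u ∈ L) : IsFactor u b3 := by
  by_cases hlen : u.length ≤ 8
  · refine isFactor_b3_iff.2 ⟨6, ?_⟩
    have h := hL.infix_of_covers (z := []) hL.forall_notMem covers_m3Iter hlen
      (by rwa [List.nil_append])
    rwa [List.nil_append] at h
  · obtain ⟨v, hv, huv, hlt⟩ := hL.exists_shorter hu (by omega)
    exact (hL.preimage.isFactor_b3 (u := v) hv).image_m3.of_infix huv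
termination_by u.length

/-- The induction hypothesis is applied to the preimage language. -/
theorem m3Iter_mem (hL : ThueLanguage L) (n : ℕ) : m3Iter n ∈ L := by
  induction n generalizing L with
  | zero => exact hL.of_infix ⟨[], [1, 2], rfl⟩ hL.mem_012
  | succ n ih =>
    rw [m3Iter_succ]
    exact ih hL.preimage

/-- Thue's theorem: the only such language is the set of factors of `b3`. -/
theorem mem_iff (hL : ThueLanguage L) {u : List (Fin 3)} : u ∈ L ↔ IsFactor u b3 := by
  refine ⟨hL.isFactor_b3, fun h => ?_⟩
  obtain ⟨n, hn⟩ := isFactor_b3_iff.1 h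
  exact hL.of_infix hn (hL.m3Iter_mem n)

end ThueLanguage

/-! ### Rotating the alphabet -/

theorem isFactor_map {α β : Type*} {g : α → β} (hg : Function.Injective g) {u : List α}
    {w : ℕ → α} : IsFactor (u.map g) (fun n => g (w n)) ↔ IsFactor u w := by
  simp [IsFactor, OccursAt, hg.eq_iff]

theorem SquareFreeLanguage.preimage_add {L : Set (List (Fin 3))} (hL : SquareFreeLanguage L)
    (k : Fin 3) : SquareFreeLanguage {u | u.map (· + k) ∈ L} where
  nil_mem := hL.nil_mem
  of_infix huv hv := hL.of_infix (huv.map _) hv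
  exists_right := by
    intro u hu
    obtain ⟨x, hx⟩ := hL.exists_right hu
    exact ⟨x - k, by simpa using hx⟩
  exists_left := by
    intro u hu
    obtain ⟨x, hx⟩ := hL.exists_left hu
    exact ⟨x - k, by simpa using hx⟩
  square_notMem := by
    intro u hu h
    rw [Set.mem_ofPred_eq, List.map_append] at h
    exact hL.square_notMem (by simpa using hu) h

/-- A square-free recurrent word whose factors avoid `010` and `212` rotated by `k` has the same
factors as `b3` rotated by `k`. -/
theorem SquareFreeLanguage.equivalent_rotation {w : ℕ → Fin 3}
    (hL : SquareFreeLanguage {u | IsFactor u w}) {k : Fin 3} (h0 : ¬ IsFactor [k, 1 + k, k] w)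
    (h2 : ¬ IsFactor [2 + k, 1 + k, 2 + k] w) : Equivalent w (fun n => b3 n + k) := by
  have hT : ThueLanguage {u | u.map (· + k) ∈ {u | IsFactor u w}} :=
    { hL.preimage_add k with
      notMem_010 := by simpa using h0
      notMem_212 := by simpa using h2 }
  intro u
  have hu : (u.map (· - k)).map (· + k) = u := by
    simp [Function.comp_def]
  conv_rhs => rw [← hu, isFactor_map (add_left_injective k), ← hT.mem_iff, Set.mem_ofPred_eq, hu]
  rfl

/-- The letter-to-letter morphisms given by permutations are not occurrences of an avoided
formula. -/
theorem Avoids.exists_letterImage {w : ℕ → Fin 3} {f : Formula} (hw : Avoids w f) :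
    ∀ Y ∈ letterImages f, ∃ y ∈ Y, y ∉ {u | IsFactor u w} := by
  have key : ∀ a b c, ∃ y ∈ f.map (image (letterMorphism a b c)), y ∉ {u | IsFactor u w} := by
    intro a b c
    by_contra! h
    exact hw ⟨letterMorphism a b c, nonErasing_letterMorphism a b c,
      fun φ hφ => h _ (List.mem_map_of_mem hφ)⟩
  simp only [letterImages, List.map_cons, List.map_nil, List.forall_mem_cons]
  exact ⟨key _ _ _, key _ _ _, key _ _ _, key _ _ _, key _ _ _, key _ _ _, by simp⟩

end WordAvoid

theorem mainTheorem6 (f : Formula)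
    (hf :
      ([[A, B, C, A], [A, B, A], [A, C, A]] ≼ f ∧
        f ≼ [[A, B, C, A], [A, B, A], [A, C, A], [A, C, B], [C, B, A]]) ∨
      ([[A, B, C, A], [A, B, A], [B, C, B], [A, C]] ≼ f ∧
        f ≼ [[A, B, C, A], [A, B, A], [A, B, C, B, A], [A, C, B]]) ∨
      ([[A, B, C, A], [A, B, A], [B, C, B], [C, B, A]] ≼ f ∧
        f ≼ [[A, B, C, A], [A, B, A], [A, B, C, B, A], [A, C, B]]))
    (w : ℕ → Fin 3) (hrec : Recurrent w) (hav : Avoids w f) :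
    Equivalent w b3 ∨
      Equivalent w (fun n => sigma (b3 n)) ∨
      Equivalent w (fun n => sigma (sigma (b3 n))) := by
  obtain ⟨g, hg, hfg⟩ : ∃ g : Formula,
      (g = [[A, B, C, A], [A, B, A], [A, C, A], [A, C, B], [C, B, A]] ∨
        g = [[A, B, C, A], [A, B, A], [A, B, C, B, A], [A, C, B]]) ∧ f ≼ g := by
    rcases hf with ⟨-, h⟩ | ⟨-, h⟩ | ⟨-, h⟩
    · exact ⟨_, Or.inl rfl, h⟩
    · exact ⟨_, Or.inr rfl, h⟩
    · exact ⟨_, Or.inr rfl, h⟩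
  have hav' : Avoids w g := hav.of_divides hfg
  have hL : SquareFreeLanguage {u | IsFactor u w} :=
    hrec.squareFreeLanguage fun u hu => hrec.not_isFactor_square hg hav' hu
  have hforce : forcesRotation [] (letterImages g) = true := by
    rcases hg with rfl | rfl
    · exact forcesRotation_five_fragments
    · exact forcesRotation_four_fragments
  obtain ⟨k, h0, h2⟩ :=
    hL.rotation_of_forcesRotation hav'.exists_letterImage (by simp) hforce
  have hw := hL.equivalent_rotation h0 h2
  have hs1 : ∀ x : Fin 3, x + 1 = sigma x := by decide
  have hs2 : ∀ x : Fin 3, x + 2 = sigma (sigma x) := by decide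
  fin_cases k
  · exact Or.inl (by simpa using hw)
  · exact Or.inr (Or.inl (by simpa [hs1] using hw))
  · exact Or.inr (Or.inr (by simpa [hs2] using hw))
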